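/- For every integer $t\ge 2$ there is a constant $c>0$ such that the following holds for every integer $n\ge t$. Let $G$ be a finite simple graph on $n$ vertices with at least $n e^{c\sqrt{\log n}}$ edges ($\log$ is the natural logarithm), and let its edges be properly coloured with an arbitrary set of colours, that is, any two distinct edges sharing a vertex receive different colours. Then $G$ contains a rainbow subdivision of the complete graph $K_t$ in which each edge of $K_t$ is replaced by a path of length at most $1300(\log n)^2$. That is, there are $t$ distinct vertices $x_1,\dots,x_t$ of $G$ and, for all $1\le i<j\le t$, a path $P_{ij}$ in $G$ from $x_i$ to $x_j$ with at most $1300(\log n)^2$ edges, such that the only vertices among $x_1,\dots,x_t$ on $P_{ij}$ are $x_i$ and $x_j$, the paths of two different pairs have no common vertex outside $\{x_1,\dots,x_t\}$, and no two distinct edges of the union of all the paths $P_{ij}$ have the same colour. -/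

import Mathlib

universe u v

namespace RainbowSubdivision

/-- An edge colouring `χ` of `G` is proper if any two distinct edges that share a vertex
receive different colours. -/
def IsProper {V : Type u} {C : Type v} {G : SimpleGraph V} (χ : G.EdgeLabeling C) : Prop :=
  ∀ e f : G.edgeSet, e ≠ f → (∃ x : V, x ∈ (e : Sym2 V) ∧ x ∈ (f : Sym2 V)) → χ e ≠ χ f

/-- A subgraph `S` of `G` is rainbow if no two of its edges have the same colour. -/
def IsRainbow {V : Type u} {C : Type v} {G : SimpleGraph V} (χ : G.EdgeLabeling C)
    (S : G.Subgraph) : Prop :=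
  ∀ e f : G.edgeSet, (e : Sym2 V) ∈ S.edgeSet → (f : Sym2 V) ∈ S.edgeSet → χ e = χ f → e = f

/-- A subdivision of the complete graph `K_t` inside `G`: distinct branch vertices
`branch 0, …, branch (t - 1)`, and for every pair `i < j` a path of `G` from `branch i` to
`branch j` replacing the edge `ij` of `K_t`. No branch vertex is an inner vertex of one of the
paths, and the paths of two different pairs meet in branch vertices only. -/
structure CliqueSubdivision {V : Type u} (G : SimpleGraph V) (t : ℕ) where
  branch : Fin t ↪ V
  path : ∀ i j : Fin t, i < j → G.Path (branch i) (branch j)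
  branch_mem : ∀ (i j : Fin t) (h : i < j) (k : Fin t),
    branch k ∈ (path i j h : G.Walk (branch i) (branch j)).support → k = i ∨ k = j
  disjoint : ∀ (i j : Fin t) (h : i < j) (k l : Fin t) (h' : k < l), (i, j) ≠ (k, l) →
    ∀ x : V, x ∈ (path i j h : G.Walk (branch i) (branch j)).support →
      x ∈ (path k l h' : G.Walk (branch k) (branch l)).support → x ∈ Set.range branch

/-- The subgraph of `G` formed by a subdivision of `K_t`: all its branch vertices together with
the union of its paths. -/
def CliqueSubdivision.toSubgraph {V : Type u} {G : SimpleGraph V} {t : ℕ}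
    (D : CliqueSubdivision G t) : G.Subgraph :=
  (⨆ i : Fin t, G.singletonSubgraph (D.branch i)) ⊔
    ⨆ (i : Fin t) (j : Fin t) (h : i < j),
      (D.path i j h : G.Walk (D.branch i) (D.branch j)).toSubgraph

end RainbowSubdivision

namespace RainbowSubdivision

open Finset
open scoped BigOperators
open scoped Classical

/-!
A set `H` of vertices that maximises (average degree) / (1 + log #H) induces a robust expander: if
few vertices outside a set `B` of at most half of `H` were adjacent to `B` after deleting few edges,
then `B` with these neighbours, or the rest of `H`, would beat the maximum.

Fix a vertex `x` of `H` and reveal random colours in `l = O(log² n)` rounds, each round revealing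
each colour independently with probability `1 / (2l)`. In every round, the set `B` of vertices
reached from `x` by rainbow walks in revealed colours grows by a factor `1 + η / 2`, where `η` is of
order `1 / log n`. Indeed, expansion gives one of two things. If many vertices outside `B` would be
reached through any one of many colours, then the colours of the round miss few of them. Otherwise
many edges lead from `B` to vertices that only few colours reach; as the colouring is proper, each
colour reaches at most `#B` of these vertices, so the number of vertices hit is concentrated.

Hence with probability more than `1 / 2` more than half of `H` is reached from `x`. A given colour
is revealed with probability at most `1 / 2`, so some permutation of the outcomes makes the colours
revealed for `x` disjoint from those revealed for another vertex `y`. For some outcome both `x` and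
`y` reach more than half of `H`; the two sets meet, which gives a rainbow path from `x` to `y`.

Deleting few vertices and few colours preserves robust expansion, so the paths of the subdivision
can be chosen greedily. A power of `log n` suffices as average degree, and `exp (c * √(log n))`
dominates every such power.
-/

/-! ### Uniform probability and random colour classes -/

section Prob

variable {Ω : Type*} [Fintype Ω]

/-- The probability that a uniformly random element of the finite type `Ω` satisfies `P`
(`0` if `Ω` is empty). -/
noncomputable def prob (P : Ω → Prop) : ℝ := 𝔼 ω, if P ω then 1 else 0

variable {P Q : Ω → Prop}

theorem prob_eq_card_div (P : Ω → Prop) : prob P = #{ω | P ω} / Fintype.card Ω := by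
  rw [prob, Fintype.expect_eq_sum_div_card, sum_boole]

theorem prob_false : prob (fun _ : Ω => False) = 0 := by simp [prob]

theorem prob_mono (h : ∀ ω, P ω → Q ω) : prob P ≤ prob Q :=
  expect_le_expect fun ω _ => by
    by_cases hP : P ω
    · simp [hP, h ω hP]
    · rw [if_neg hP]; positivity

theorem mul_prob_le_expect {f : Ω → ℝ} {a : ℝ} (hf : ∀ ω, 0 ≤ f ω) (h : ∀ ω, P ω → a ≤ f ω) :
    a * prob P ≤ 𝔼 ω, f ω := by
  rw [prob, mul_expect]
  refine expect_le_expect fun ω _ => ?_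
  by_cases hP : P ω
  · simpa [hP] using h ω hP
  · simpa [hP] using hf ω

theorem expect_card_filter_eq_sum_prob {α : Type*} (s : Finset α) (R : α → Ω → Prop)
    [∀ ω, DecidablePred (R · ω)] :
    𝔼 ω, (#{a ∈ s | R a ω} : ℝ) = ∑ a ∈ s, prob (R a) := by
  simp only [card_filter, Nat.cast_sum, Nat.cast_ite, Nat.cast_one, Nat.cast_zero,
    expect_sum_comm, prob]
  congr!

theorem prob_exists_le_sum {ι : Type*} [Fintype ι] (P : ι → Ω → Prop) :
    prob (fun ω => ∃ i, P i ω) ≤ ∑ i, prob (P i) := by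
  rw [← expect_card_filter_eq_sum_prob, ← one_mul (prob _)]
  refine mul_prob_le_expect (fun ω => Nat.cast_nonneg _) fun ω ⟨i, hi⟩ => ?_
  exact_mod_cast card_pos.2 ⟨i, by simpa using hi⟩

theorem prob_exists_le_card_mul {ι : Type*} [Fintype ι] {P : ι → Ω → Prop} {r : ℝ}
    (h : ∀ i, prob (P i) ≤ r) : prob (fun ω => ∃ i, P i ω) ≤ Fintype.card ι * r := by
  rw [← nsmul_eq_mul, ← card_univ]
  exact (prob_exists_le_sum P).trans (sum_le_card_nsmul _ _ _ fun i _ => h i)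

theorem prob_comp_equiv (e : Ω ≃ Ω) (P : Ω → Prop) : prob (fun ω => P (e ω)) = prob P :=
  Fintype.expect_equiv e _ _ fun _ => rfl

theorem exists_not_and_not_of_prob_lt_half (hP : prob P < 1 / 2) (hQ : prob Q < 1 / 2)
    [Nonempty Ω] : ∃ ω, ¬ P ω ∧ ¬ Q ω := by
  have hlt : 𝔼 ω, ((if P ω then 1 else 0) + if Q ω then (1 : ℝ) else 0) < 1 := by
    rw [expect_add_distrib]
    unfold prob at hP hQ
    linarith
  obtain ⟨ω, -, hω⟩ := exists_lt_of_expect_lt univ_nonempty hlt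
  refine ⟨ω, fun h => ?_, fun h => ?_⟩
  · rw [if_pos h] at hω
    split_ifs at hω <;> norm_num at hω
  · rw [if_pos h] at hω
    split_ifs at hω <;> norm_num at hω

theorem prob_le_of_update {ι X : Type*} [Fintype ι] [DecidableEq ι] [Fintype X] [Nonempty X]
    {P : (ι → X) → Prop} (i : ι) {r : ℝ}
    (h : ∀ g : ι → X, prob (fun x => P (Function.update g i x)) ≤ r) : prob P ≤ r := by
  have hresample : prob P = 𝔼 g : ι → X, prob fun x => P (Function.update g i x) := by
    let e : (ι → X) × X ≃ (ι → X) × X :=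
      { toFun q := (Function.update q.1 i q.2, q.1 i)
        invFun q := (Function.update q.1 i q.2, q.1 i)
        left_inv q := by simp
        right_inv q := by simp }
    calc prob P = 𝔼 g : ι → X, 𝔼 _x : X, if P g then (1 : ℝ) else 0 := by
          simp only [Fintype.expect_const, prob]
      _ = 𝔼 q : (ι → X) × X, if P q.1 then (1 : ℝ) else 0 := by
          rw [← univ_product_univ, expect_product]
      _ = 𝔼 q : (ι → X) × X, if P (Function.update q.1 i q.2) then (1 : ℝ) else 0 :=
          (Fintype.expect_equiv e _ _ fun _ => rfl).symm
      _ = 𝔼 g : ι → X, prob fun x => P (Function.update g i x) := by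
          rw [← univ_product_univ, expect_product]; rfl
  rw [hresample]
  exact expect_le univ_nonempty fun g _ => h g

theorem exists_perm_forall_not_of_prob_le_half (h : prob P ≤ 1 / 2) :
    ∃ σ : Equiv.Perm Ω, ∀ ω, P ω → ¬ P (σ ω) := by
  have hle : #{ω | P ω} ≤ #({ω | P ω} : Finset Ω)ᶜ := by
    rcases isEmpty_or_nonempty Ω with _ | _
    · simp
    have hΩ : (0 : ℝ) < Fintype.card Ω := by exact_mod_cast Fintype.card_pos
    rw [prob_eq_card_div, div_le_div_iff₀ hΩ two_pos, one_mul] at h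
    have h' : #{ω | P ω} * 2 ≤ Fintype.card Ω := by exact_mod_cast h
    rw [card_compl]
    omega
  obtain ⟨T, hT, hcard⟩ := exists_subset_card_eq hle
  have hequiv : Fintype.card {ω // P ω} = Fintype.card {ω // ω ∈ T} := by
    rw [Fintype.card_subtype, Fintype.card_coe, hcard]
  let e : {ω // P ω} ≃ {ω // ω ∈ T} := Fintype.equivOfCardEq hequiv
  exact ⟨e.extendSubtype, fun ω hω => by simpa using hT (e.extendSubtype_mem ω hω)⟩

end Prob

section RandomColourClass

/-! A random function `u : K → Fin m` is used as a random subset `{c | u c = 0}` of `K`, which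
contains each element with probability `1 / m`, independently. -/

variable {K : Type*} [Fintype K] {m : ℕ} [NeZero m]

theorem expect_prod_apply {X : Type*} [Fintype X] (f : K → X → ℝ) :
    𝔼 u : K → X, ∏ c, f c (u c) = ∏ c, 𝔼 j, f c j := by
  simp only [Fintype.expect_eq_sum_div_card, prod_div_distrib, Fintype.prod_sum, prod_const,
    Fintype.card_fun, Nat.cast_pow, card_univ]

theorem expect_exp_neg_ite_le {a : ℝ} (h0 : 0 ≤ a) (h1 : a ≤ 1) :
    𝔼 j : Fin m, Real.exp (-if j = 0 then a else 0) ≤ Real.exp (-a / (2 * m)) := by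
  have hm : (0 : ℝ) < m := by exact_mod_cast NeZero.pos m
  have hexp : Real.exp (-a) ≤ 1 - a / 2 := by
    have hinv : Real.exp (-a) * Real.exp a = 1 := by rw [← Real.exp_add]; simp
    have hone : 1 ≤ (1 - a / 2) * Real.exp a := by nlinarith [Real.add_one_le_exp a]
    exact le_of_mul_le_mul_right (hinv.le.trans hone) (Real.exp_pos _)
  have hsplit (j : Fin m) : Real.exp (-if j = 0 then a else 0) =
      1 + if j = 0 then Real.exp (-a) - 1 else 0 := by
    split_ifs <;> simp
  calc 𝔼 j : Fin m, Real.exp (-if j = 0 then a else 0) = 1 + (Real.exp (-a) - 1) / m := by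
        rw [expect_congr rfl fun j _ => hsplit j, expect_add_distrib, Fintype.expect_const,
          Fintype.expect_eq_sum_div_card, sum_ite_eq' univ 0, if_pos (mem_univ _),
          Fintype.card_fin]
    _ ≤ 1 + (-a / 2) / m := by gcongr; linarith
    _ = -a / (2 * m) + 1 := by rw [div_div]; ring
    _ ≤ Real.exp (-a / (2 * m)) := Real.add_one_le_exp _

theorem expect_exp_neg_sum_le {a : K → ℝ} (h0 : ∀ c, 0 ≤ a c) (h1 : ∀ c, a c ≤ 1) :
    𝔼 u : K → Fin m, Real.exp (-∑ c with u c = 0, a c) ≤ Real.exp (-(∑ c, a c) / (2 * m)) := by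
  calc 𝔼 u : K → Fin m, Real.exp (-∑ c with u c = 0, a c)
      = 𝔼 u : K → Fin m, ∏ c, Real.exp (-if u c = 0 then a c else 0) := by
        simp only [sum_filter, ← Real.exp_sum, sum_neg_distrib]
    _ = ∏ c, 𝔼 j : Fin m, Real.exp (-if j = 0 then a c else 0) :=
        expect_prod_apply fun c (j : Fin m) => Real.exp (-if j = 0 then a c else 0)
    _ ≤ ∏ c, Real.exp (-a c / (2 * m)) :=
        prod_le_prod (fun c _ => expect_nonneg fun _ _ => (Real.exp_pos _).le)
          fun c _ => expect_exp_neg_ite_le (h0 c) (h1 c)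
    _ = Real.exp (-(∑ c, a c) / (2 * m)) := by
        rw [← Real.exp_sum, ← sum_div, sum_neg_distrib]

theorem prob_forall_ne_zero_le (T : Finset K) :
    prob (fun u : K → Fin m => ∀ c ∈ T, u c ≠ 0) ≤ Real.exp (-#T / (2 * m)) := by
  have hmoment := expect_exp_neg_sum_le (m := m) (a := fun c => if c ∈ T then (1 : ℝ) else 0)
    (fun c => by positivity) (fun c => by split_ifs <;> norm_num)
  rw [sum_boole, filter_univ_mem] at hmoment
  refine le_trans ?_ hmoment
  rw [← one_mul (prob _)]
  refine mul_prob_le_expect (fun u => (Real.exp_pos _).le) fun u hu => ?_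
  rw [sum_eq_zero, neg_zero, Real.exp_zero]
  exact fun c hc => if_neg fun hcT => hu c hcT (mem_filter.1 hc).2

theorem prob_card_hit_lt_half_le {α : Type*} {W : Finset α} {T : α → Finset K} {k : ℕ}
    (hT : ∀ w ∈ W, k ≤ #(T w)) :
    prob (fun u : K → Fin m => (#{w ∈ W | ∃ c ∈ T w, u c = 0} : ℝ) < #W / 2) ≤
      2 * Real.exp (-k / (2 * m)) := by
  rcases W.eq_empty_or_nonempty with rfl | hW
  · simp only [filter_empty, card_empty, Nat.cast_zero, zero_div, lt_irrefl, prob_false]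
    positivity
  have hWpos : (0 : ℝ) < #W := by exact_mod_cast hW.card_pos
  have hmissed : ∀ w ∈ W, prob (fun u : K → Fin m => ¬ ∃ c ∈ T w, u c = 0) ≤
      Real.exp (-k / (2 * m)) := by
    intro w hw
    push Not
    refine (prob_forall_ne_zero_le (T w)).trans ?_
    gcongr
    exact hT w hw
  have hmarkov : #W / 2 * prob (fun u : K → Fin m =>
      (#{w ∈ W | ∃ c ∈ T w, u c = 0} : ℝ) < #W / 2) ≤
        ∑ w ∈ W, prob fun u : K → Fin m => ¬ ∃ c ∈ T w, u c = 0 := by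
    rw [← expect_card_filter_eq_sum_prob]
    refine mul_prob_le_expect (fun u => Nat.cast_nonneg _) fun u hu => ?_
    have hcard : (#{w ∈ W | ∃ c ∈ T w, u c = 0} : ℝ) + #{w ∈ W | ¬ ∃ c ∈ T w, u c = 0} = #W := by
      exact_mod_cast card_filter_add_card_filter_not (s := W) fun w => ∃ c ∈ T w, u c = 0
    linarith
  have hsum := sum_le_card_nsmul W _ _ hmissed
  rw [nsmul_eq_mul] at hsum
  refine le_of_mul_le_mul_left ?_ (half_pos hWpos)
  linarith

theorem prob_card_map_eq_zero_le_le {α : Type*} {W : Finset α} {f : α → K} {b : ℕ} (hb : 0 < b)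
    (hf : ∀ c, #{w ∈ W | f w = c} ≤ b) :
    prob (fun u : K → Fin m => #{w ∈ W | u (f w) = 0} ≤ b) ≤
      Real.exp (1 - #W / (2 * m * b)) := by
  have hb' : (0 : ℝ) < b := by exact_mod_cast hb
  have hmoment := expect_exp_neg_sum_le (m := m)
    (a := fun c => (#{w ∈ W | f w = c} : ℝ) / b) (fun c => by positivity)
    (fun c => by rw [div_le_one hb']; exact_mod_cast hf c)
  have htotal : ∑ c, (#{w ∈ W | f w = c} : ℝ) / b = #W / b := by
    rw [← sum_div, card_eq_sum_card_fiberwise (fun w _ => mem_univ (f w)), Nat.cast_sum]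
  have hhit (u : K → Fin m) : ∑ c with u c = 0, (#{w ∈ W | f w = c} : ℝ) / b =
      #{w ∈ W | u (f w) = 0} / b := by
    rw [← sum_div, card_eq_sum_card_fiberwise (s := {w ∈ W | u (f w) = 0}) (f := f)
      (t := {c | u c = 0}) (fun w hw => by simpa using (mem_filter.1 hw).2), Nat.cast_sum]
    congr 1
    refine sum_congr rfl fun c hc => ?_
    rw [filter_filter]
    congr 2
    refine filter_congr fun w _ => ?_
    rw [iff_and_self]
    rintro rfl
    exact (mem_filter.1 hc).2
  have hmarkov : Real.exp (-1) * prob (fun u : K → Fin m => #{w ∈ W | u (f w) = 0} ≤ b) ≤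
      Real.exp (-(#W / b) / (2 * m)) := by
    rw [htotal] at hmoment
    refine le_trans (mul_prob_le_expect (fun u => (Real.exp_pos _).le) fun u hu => ?_) hmoment
    rw [hhit, Real.exp_le_exp, neg_le_neg_iff, div_le_one hb']
    exact_mod_cast hu
  calc prob (fun u : K → Fin m => #{w ∈ W | u (f w) = 0} ≤ b)
      = Real.exp 1 * (Real.exp (-1) *
          prob (fun u : K → Fin m => #{w ∈ W | u (f w) = 0} ≤ b)) := by
        rw [← mul_assoc, ← Real.exp_add]; simp
    _ ≤ Real.exp 1 * Real.exp (-(#W / b) / (2 * m)) := by gcongr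
    _ = Real.exp (1 - #W / (2 * m * b)) := by
        rw [← Real.exp_add]
        congr 1
        field_simp
        ring

theorem prob_card_hit_le_le [Nonempty K] {α : Type*} {W : Finset α} {T : α → Finset K} {b k : ℕ}
    {δ : ℝ} (hb : 0 < b) (hk : 0 < k) (hfibre : ∀ c, #{w ∈ W | c ∈ T w} ≤ b)
    (hsum : δ * b ≤ ∑ w ∈ W with #(T w) < k, (#(T w) : ℝ)) :
    prob (fun u : K → Fin m => #{w ∈ W | ∃ c ∈ T w, u c = 0} ≤ b) ≤
      Real.exp (1 - δ / (2 * m * k)) := by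
  set W' : Finset α := {w ∈ W | #(T w) < k ∧ (T w).Nonempty}
  have hW' {w : α} (hw : w ∈ W') : w ∈ W ∧ #(T w) < k ∧ (T w).Nonempty := mem_filter.1 hw
  have hcard : δ * b ≤ k * #W' := by
    calc δ * b ≤ ∑ w ∈ W with #(T w) < k, (#(T w) : ℝ) := hsum
      _ = ∑ w ∈ W', (#(T w) : ℝ) := by
          refine (sum_subset (monotone_filter_right _ fun w _ hw => hw.1) fun w hw hw' => ?_).symm
          rw [mem_filter] at hw
          rw [not_nonempty_iff_eq_empty.1 fun hT => hw' (mem_filter.2 ⟨hw.1, hw.2, hT⟩)]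
          simp
      _ ≤ k * #W' := by
          rw [mul_comm, ← nsmul_eq_mul]
          exact sum_le_card_nsmul _ _ _ fun w hw => by exact_mod_cast (hW' hw).2.1.le
  choose! f hf using fun w (hw : w ∈ W') => (hW' hw).2.2
  have hf_fibre (c : K) : #{w ∈ W' | f w = c} ≤ b := by
    refine (card_le_card fun w hw => ?_).trans (hfibre c)
    obtain ⟨hwW', rfl⟩ := mem_filter.1 hw
    exact mem_filter.2 ⟨(hW' hwW').1, hf w hwW'⟩
  refine (prob_mono fun u hu => ?_).trans ((prob_card_map_eq_zero_le_le hb hf_fibre).trans ?_)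
  · refine (card_le_card fun w hw => ?_).trans hu
    obtain ⟨hwW', hw0⟩ := mem_filter.1 hw
    exact mem_filter.2 ⟨(hW' hwW').1, f w, hf w hwW', hw0⟩
  · have hm : (0 : ℝ) < m := by exact_mod_cast NeZero.pos m
    refine Real.exp_le_exp.2 (sub_le_sub_left ?_ 1)
    rw [div_le_div_iff₀ (by positivity) (by positivity)]
    nlinarith [mul_le_mul_of_nonneg_left hcard hm.le]

theorem prob_card_hit_lt_le [Nonempty K] {α : Type*} {W : Finset α} {T : α → Finset K} {b k : ℕ}
    {η δ : ℝ} (hb : 0 < b) (hk : 0 < k) (hη : η ≤ 2) (hfibre : ∀ c, #{w ∈ W | c ∈ T w} ≤ b)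
    (h : η * b ≤ #{w ∈ W | k ≤ #(T w)} ∨ δ * b ≤ ∑ w ∈ W with #(T w) < k, (#(T w) : ℝ)) :
    prob (fun u : K → Fin m => (#{w ∈ W | ∃ c ∈ T w, u c = 0} : ℝ) < η / 2 * b) ≤
      2 * Real.exp (-k / (2 * m)) + Real.exp (1 - δ / (2 * m * k)) := by
  rcases h with hhigh | hlow
  · refine le_add_of_le_of_nonneg ?_ (Real.exp_pos _).le
    refine (prob_mono fun u hu => ?_).trans
      (prob_card_hit_lt_half_le (W := {w ∈ W | k ≤ #(T w)}) fun w hw => (mem_filter.1 hw).2)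
    refine lt_of_le_of_lt (Nat.cast_le.2 (card_le_card ?_)) (hu.trans_le (by linarith))
    exact filter_subset_filter _ (filter_subset _ _)
  · refine le_add_of_nonneg_of_le (by positivity) ?_
    refine (prob_mono fun u hu => ?_).trans (prob_card_hit_le_le hb hk hfibre hlow)
    have hηb : η / 2 * b ≤ b := mul_le_of_le_one_left (Nat.cast_nonneg b) (by linarith)
    exact_mod_cast (hu.trans_le hηb).le

end RandomColourClass

/-! ### Robust expanders -/

section Expander

variable {V : Type*} {G : SimpleGraph V} {H : Finset V} {η δ : ℝ}

/-- The average degree of the subgraph of `G` induced on `S` (`0` if `S` is empty); note that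
`G.interedges S S` contains every edge inside `S` twice, once in each direction. -/
noncomputable def avgDegree (G : SimpleGraph V) (S : Finset V) : ℝ := #(G.interedges S S) / #S

/-- The subgraph of `G` induced on `H` is a robust `(η, δ)`-expander: every nonempty set `B` of at
most half of the vertices of `H` has at least `η * #B` neighbours in `H \ B`, even after the
deletion of any `δ * #B` edges. The deleted edges leaving `B` are listed as pairs whose first
component is in `B`. -/
def IsRobustExpander (G : SimpleGraph V) (H : Finset V) (η δ : ℝ) : Prop :=
  ∀ B ⊆ H, B.Nonempty → 2 * #B ≤ #H → ∀ F : Finset (V × V), (#F : ℝ) ≤ δ * #B →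
    η * #B ≤ #{w ∈ H \ B | ∃ v ∈ B, G.Adj v w ∧ (v, w) ∉ F}

/-- `H` maximises `avgDegree G H / (1 + log #H)` among the sets of vertices of `G`. -/
def IsLogDensityMax (G : SimpleGraph V) (H : Finset V) : Prop :=
  ∀ S : Finset V, avgDegree G S * (1 + Real.log #H) ≤ avgDegree G H * (1 + Real.log #S)

theorem avgDegree_nonneg (G : SimpleGraph V) (S : Finset V) : 0 ≤ avgDegree G S := by
  unfold avgDegree; positivity

theorem avgDegree_empty (G : SimpleGraph V) : avgDegree G ∅ = 0 := by simp [avgDegree]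

theorem avgDegree_mul_card (G : SimpleGraph V) (S : Finset V) :
    avgDegree G S * #S = #(G.interedges S S) := by
  rcases S.eq_empty_or_nonempty with rfl | hS
  · simp
  · exact div_mul_cancel₀ _ (Nat.cast_ne_zero.2 hS.card_ne_zero)

theorem avgDegree_le_card (G : SimpleGraph V) (S : Finset V) : avgDegree G S ≤ #S :=
  div_le_of_le_mul₀ (Nat.cast_nonneg _) (Nat.cast_nonneg _)
    (by exact_mod_cast G.card_interedges_le_mul S S)

theorem avgDegree_univ_mul_card [Fintype V] (G : SimpleGraph V) :
    avgDegree G univ * Fintype.card V = 2 * G.edgeSet.ncard := by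
  have hdegree : #(G.interedges univ univ) = ∑ v, G.degree v := by
    rw [G.interedges_def, card_filter, univ_product_univ, Fintype.sum_prod_type]
    refine sum_congr rfl fun v _ => ?_
    rw [← card_filter, ← SimpleGraph.card_neighborFinset_eq_degree, G.neighborFinset_eq_filter]
  rw [← card_univ, avgDegree_mul_card, hdegree, G.sum_degrees_eq_twice_card_edges,
    ← G.coe_edgeFinset, Set.ncard_coe_finset]
  push_cast
  rfl

theorem one_add_log_card_pos (S : Finset V) : 0 < 1 + Real.log #S :=
  add_pos_of_pos_of_nonneg one_pos (Real.log_natCast_nonneg _)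

theorem exists_isLogDensityMax [Finite V] [Nonempty V] (G : SimpleGraph V) :
    ∃ H : Finset V, H.Nonempty ∧ IsLogDensityMax G H := by
  have := Fintype.ofFinite V
  obtain ⟨H, hH, hmax⟩ := exists_max_image ({S | S.Nonempty} : Finset (Finset V))
    (fun S => avgDegree G S / (1 + Real.log #S)) ⟨univ, by simp⟩
  refine ⟨H, (mem_filter.1 hH).2, fun S => ?_⟩
  rcases S.eq_empty_or_nonempty with rfl | hS
  · simp [avgDegree_empty, avgDegree_nonneg]
  · rw [← div_le_div_iff₀ (one_add_log_card_pos S) (one_add_log_card_pos H)]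
    exact hmax S (by simpa using hS)

theorem IsLogDensityMax.avgDegree_le_of_subset (hH : IsLogDensityMax G H) {S : Finset V}
    (hS : S ⊆ H) : avgDegree G S ≤ avgDegree G H := by
  rcases S.eq_empty_or_nonempty with rfl | hne
  · simp [avgDegree_empty, avgDegree_nonneg]
  have hlog : Real.log #S ≤ Real.log #H :=
    Real.log_le_log (by exact_mod_cast hne.card_pos) (by exact_mod_cast card_le_card hS)
  refine le_of_mul_le_mul_right ((hH S).trans ?_) (one_add_log_card_pos H)
  gcongr
  exact avgDegree_nonneg G H

theorem IsLogDensityMax.avgDegree_le_of_card_le (hH : IsLogDensityMax G H) {S : Finset V}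
    (hne : S.Nonempty) (hS : (#S : ℝ) ≤ 2 / 3 * #H) :
    avgDegree G S ≤ avgDegree G H * (1 - 1 / (3 * (1 + Real.log #H))) := by
  have hSpos : (0 : ℝ) < #S := by exact_mod_cast hne.card_pos
  have hlog : Real.log #S ≤ Real.log #H - 1 / 3 := by
    have hlog' := Real.log_le_log hSpos hS
    rw [Real.log_mul (by norm_num) (by linarith)] at hlog'
    linarith [Real.log_le_sub_one_of_pos (show (0 : ℝ) < 2 / 3 by norm_num)]
  have hL := one_add_log_card_pos H
  refine le_of_mul_le_mul_right ((hH S).trans ?_) hL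
  calc avgDegree G H * (1 + Real.log #S) ≤ avgDegree G H * (1 + Real.log #H - 1 / 3) := by
        gcongr
        · exact avgDegree_nonneg G H
        · linarith
    _ = avgDegree G H * (1 - 1 / (3 * (1 + Real.log #H))) * (1 + Real.log #H) := by
        field_simp

theorem IsLogDensityMax.card_interedges_sdiff_le (hH : IsLogDensityMax G H) {B : Finset V}
    (hB : B ⊆ H) : (#(G.interedges (H \ B) (H \ B)) : ℝ) ≤ avgDegree G H * (#H - #B) := by
  rw [← avgDegree_mul_card, ← cast_card_sdiff hB]
  exact mul_le_mul_of_nonneg_right (hH.avgDegree_le_of_subset sdiff_subset) (Nat.cast_nonneg _)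

theorem card_interedges_le_of_deleted (G : SimpleGraph V) (H B : Finset V) (F : Finset (V × V)) :
    #(G.interedges H H) ≤
      #(G.interedges (B ∪ {w ∈ H \ B | ∃ v ∈ B, G.Adj v w ∧ (v, w) ∉ F})
        (B ∪ {w ∈ H \ B | ∃ v ∈ B, G.Adj v w ∧ (v, w) ∉ F})) +
        #(G.interedges (H \ B) (H \ B)) + 2 * #F := by
  set N : Finset V := {w ∈ H \ B | ∃ v ∈ B, G.Adj v w ∧ (v, w) ∉ F} with hN
  have hsub : G.interedges H H ⊆
      G.interedges (B ∪ N) (B ∪ N) ∪ G.interedges (H \ B) (H \ B) ∪ (F ∪ F.image Prod.swap) := by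
    rintro ⟨a, b⟩ hab
    obtain ⟨ha, hb, hadj⟩ := Rel.mk_mem_interedges_iff.1 hab
    simp only [mem_union, SimpleGraph.mk_mem_interedges_iff, mem_sdiff, hN, mem_filter, mem_image,
      Prod.exists, Prod.swap_prod_mk, Prod.mk.injEq]
    grind [SimpleGraph.adj_comm]
  have himage : #(F.image Prod.swap) ≤ #F := card_image_le
  have hunion := (card_le_card hsub).trans (card_union_le _ _)
  have hleft := card_union_le (G.interedges (B ∪ N) (B ∪ N)) (G.interedges (H \ B) (H \ B))
  have hright := card_union_le F (F.image Prod.swap)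
  omega

theorem IsLogDensityMax.isRobustExpander (hH : IsLogDensityMax G H) (hpos : 0 < avgDegree G H) :
    IsRobustExpander G H (1 / (6 * (1 + Real.log #H)))
      (avgDegree G H / (12 * (1 + Real.log #H))) := by
  intro B hBH hB hhalf F hF
  have hLpos := one_add_log_card_pos H
  set L : ℝ := 1 + Real.log #H with hL
  set D : ℝ := avgDegree G H with hD
  set θ : ℝ := 1 / (6 * L) with hθ
  set N : Finset V := {w ∈ H \ B | ∃ v ∈ B, G.Adj v w ∧ (v, w) ∉ F} with hN
  by_contra! hsmall
  have hL1 : 1 ≤ L := le_add_of_nonneg_right (Real.log_natCast_nonneg _)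
  have hθpos : 0 < θ := by positivity
  have hθ6 : θ ≤ 1 / 6 := one_div_le_one_div_of_le (by norm_num) (by linarith)
  have hb : (0 : ℝ) < #B := by exact_mod_cast hB.card_pos
  have hhalf' : 2 * (#B : ℝ) ≤ #H := by exact_mod_cast hhalf
  have hBN : (#(B ∪ N) : ℝ) ≤ (1 + θ) * #B := by
    have hunion : (#(B ∪ N) : ℝ) ≤ #B + #N := by exact_mod_cast card_union_le B N
    linarith
  have hinside : (#(G.interedges (B ∪ N) (B ∪ N)) : ℝ) ≤ D * (1 - 2 * θ) * ((1 + θ) * #B) := by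
    have hθL : 1 / (3 * L) = 2 * θ := by rw [hθ]; field_simp; norm_num
    have havg := hH.avgDegree_le_of_card_le (hB.mono (subset_union_left (s₂ := N)))
      (by nlinarith)
    rw [← hL, hθL, ← hD] at havg
    rw [← avgDegree_mul_card]
    have : 0 ≤ 1 - 2 * θ := by linarith
    gcongr
  have houtside : (#(G.interedges (H \ B) (H \ B)) : ℝ) ≤ D * (#H - #B) :=
    hH.card_interedges_sdiff_le hBH
  have hF' : 2 * (#F : ℝ) ≤ D * (θ * #B) := by
    have hδ : D / (12 * L) = D * θ / 2 := by rw [hθ]; field_simp; norm_num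
    rw [hδ] at hF
    linarith
  have hcount : (#(G.interedges H H) : ℝ) ≤ #(G.interedges (B ∪ N) (B ∪ N)) +
      #(G.interedges (H \ B) (H \ B)) + 2 * #F := by
    exact_mod_cast card_interedges_le_of_deleted G H B F
  rw [← avgDegree_mul_card] at hcount
  have hloss : 0 < D * #B * θ ^ 2 := by positivity
  linarith

theorem exists_isRobustExpander [Fintype V] [Nonempty V] (G : SimpleGraph V) {d : ℝ} (hd : 0 < d)
    (hG : d ≤ avgDegree G univ) :
    ∃ H : Finset V, H.Nonempty ∧ d / (1 + Real.log (Fintype.card V)) ≤ #H ∧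
      IsRobustExpander G H (1 / (6 * (1 + Real.log #H)))
        (d / (12 * (1 + Real.log (Fintype.card V)))) := by
  obtain ⟨H, hne, hH⟩ := exists_isLogDensityMax G
  have hLH := one_add_log_card_pos H
  have hLn := one_add_log_card_pos (univ : Finset V)
  have hmax := hH univ
  rw [card_univ] at hLn hmax
  have hdensity : d / (1 + Real.log (Fintype.card V)) ≤ avgDegree G H / (1 + Real.log #H) := by
    rw [div_le_div_iff₀ hLn hLH]
    exact (mul_le_mul_of_nonneg_right hG hLH.le).trans hmax
  have hdpos : 0 < d / (1 + Real.log (Fintype.card V)) := div_pos hd hLn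
  have hDpos : 0 < avgDegree G H := (div_pos_iff_of_pos_right hLH).1 (hdpos.trans_le hdensity)
  refine ⟨H, hne, ?_, fun B hBH hB hhalf F hF => ?_⟩
  · refine hdensity.trans ((div_le_self hDpos.le ?_).trans (avgDegree_le_card G H))
    exact le_add_of_nonneg_right (Real.log_natCast_nonneg _)
  · refine hH.isRobustExpander hDpos B hBH hB hhalf F (hF.trans ?_)
    rw [mul_comm (12 : ℝ), mul_comm (12 : ℝ), ← div_div, ← div_div]
    gcongr

theorem card_filter_product_le_mul {α β : Type*} {B : Finset α} {W : Finset β} (R : α → β → Prop)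
    [∀ v, DecidablePred (R v)] {r : ℝ} (hR : ∀ v ∈ B, (#{w ∈ W | R v w} : ℝ) ≤ r) :
    (#{p ∈ B ×ˢ W | R p.1 p.2} : ℝ) ≤ r * #B := by
  have hsum : #{p ∈ B ×ˢ W | R p.1 p.2} = ∑ v ∈ B, #{w ∈ W | R v w} := by
    simp only [card_filter, sum_product]
  rw [hsum, Nat.cast_sum, mul_comm, ← nsmul_eq_mul]
  exact sum_le_card_nsmul _ _ _ hR

theorem IsRobustExpander.of_card_deleted_le {G' : SimpleGraph V} {H' : Finset V} {r : ℝ}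
    (hH : IsRobustExpander G H η δ) (hH' : H' ⊆ H)
    (hr : ∀ v ∈ H', (#{w ∈ H | G.Adj v w ∧ ¬ (G'.Adj v w ∧ w ∈ H')} : ℝ) ≤ r) :
    IsRobustExpander G' H' η (δ - r) := by
  intro B hB hne hhalf F hF
  have hdeleted := card_filter_product_le_mul
    (fun v w => G.Adj v w ∧ ¬ (G'.Adj v w ∧ w ∈ H')) fun v hv => hr v (hB hv)
  set F' : Finset (V × V) := {p ∈ B ×ˢ H | G.Adj p.1 p.2 ∧ ¬ (G'.Adj p.1 p.2 ∧ p.2 ∈ H')}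
  have hF' : (#(F ∪ F') : ℝ) ≤ δ * #B := by
    have hunion : (#(F ∪ F') : ℝ) ≤ #F + #F' := by exact_mod_cast card_union_le F F'
    linarith
  refine (hH B (hB.trans hH') hne (hhalf.trans (card_le_card hH')) _ hF').trans ?_
  refine Nat.cast_le.2 (card_le_card fun w hw => ?_)
  obtain ⟨hwHB, v, hv, hvw, hvwF⟩ := mem_filter.1 hw
  obtain ⟨hwH, hwB⟩ := mem_sdiff.1 hwHB
  rw [mem_union, not_or] at hvwF
  have hkept : G'.Adj v w ∧ w ∈ H' := by
    by_contra hdel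
    exact hvwF.2 (mem_filter.2 ⟨mk_mem_product hv hwH, hvw, hdel⟩)
  exact mem_filter.2 ⟨mem_sdiff.2 ⟨hkept.2, hwB⟩, v, hv, hkept.1, hvwF.1⟩

end Expander

/-! ### Vertices reached by rainbow walks -/

section Reach

variable {V K : Type*} {G : SimpleGraph V} {κ : Sym2 V → K} {H : Finset V} {x : V}

/-- The colouring `κ`, restricted to the edges of `G`, is a proper edge colouring. In contrast to
`IsProper` the colouring is a total function on `Sym2 V`, whose values off the edges of `G` are
irrelevant. -/
def ProperOn (G : SimpleGraph V) (κ : Sym2 V → K) : Prop :=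
  ∀ ⦃a b c : V⦄, G.Adj a b → G.Adj a c → κ s(a, b) = κ s(a, c) → b = c

/-- The walk `p` has length at most `i`, has pairwise distinct edge colours, and uses only colours
in `A`. -/
structure IsRainbowWalk (κ : Sym2 V → K) (A : Set K) (i : ℕ) {v w : V} (p : G.Walk v w) :
    Prop where
  length_le : p.length ≤ i
  nodup : (p.edges.map κ).Nodup
  color_mem : ∀ e ∈ p.edges, κ e ∈ A

/-- The vertices of `H` that can be reached from `x` by a rainbow walk of length at most `i` with
colours in `A`. -/
noncomputable def reach (G : SimpleGraph V) (κ : Sym2 V → K) (H : Finset V) (x : V) (A : Set K)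
    (i : ℕ) : Finset V :=
  {v ∈ H | ∃ p : G.Walk x v, IsRainbowWalk κ A i p}

/-- The colours through which `w` can be reached in one further step: those of an edge `vw` that
extends to `w` some rainbow walk of length at most `i` from `x` to `v` with colours in `A`. Such a
colour need not lie in `A`. -/
noncomputable def newColors [Fintype K] (G : SimpleGraph V) (κ : Sym2 V → K) (H : Finset V) (x : V)
    (A : Set K) (i : ℕ) (w : V) : Finset K :=
  {c | ∃ v ∈ H, ∃ p : G.Walk x v, IsRainbowWalk κ A i p ∧ G.Adj v w ∧ κ s(v, w) = c ∧
    c ∉ p.edges.map κ}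

theorem ProperOn.card_filter_color_mem_le (hκ : ProperOn G κ) (v : V) (W : Finset V)
    (C : Finset K) : #{w ∈ W | G.Adj v w ∧ κ s(v, w) ∈ C} ≤ #C := by
  refine card_le_card_of_injOn (fun w => κ s(v, w)) (fun w hw => ?_) fun w hw w' hw' h => ?_
  · exact (mem_filter.1 hw).2.2
  · exact hκ (mem_filter.1 hw).2.1 (mem_filter.1 hw').2.1 h

theorem IsRainbowWalk.mono {A A' : Set K} {i j : ℕ} {v w : V} {p : G.Walk v w}
    (hp : IsRainbowWalk κ A i p) (hA : A ⊆ A') (hij : i ≤ j) : IsRainbowWalk κ A' j p :=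
  ⟨hp.length_le.trans hij, hp.nodup, fun e he => hA (hp.color_mem e he)⟩

theorem reach_mono {A A' : Set K} {i j : ℕ} (hA : A ⊆ A') (hij : i ≤ j) :
    reach G κ H x A i ⊆ reach G κ H x A' j :=
  monotone_filter_right H fun _ _ ⟨p, hp⟩ => ⟨p, hp.mono hA hij⟩

theorem self_mem_reach (hx : x ∈ H) (A : Set K) (i : ℕ) : x ∈ reach G κ H x A i :=
  mem_filter.2 ⟨hx, .nil, by simp, by simp, by simp⟩

variable [Fintype K] {A : Set K} {i : ℕ}

theorem mem_reach_succ_of_mem_newColors {A' : Set K} (hA : A ⊆ A') {w : V} (hw : w ∈ H) {c : K}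
    (hc : c ∈ newColors G κ H x A i w) (hcA : c ∈ A') : w ∈ reach G κ H x A' (i + 1) := by
  obtain ⟨-, v, -, p, hp, hvw, rfl, hnew⟩ := mem_filter.1 hc
  refine mem_filter.2 ⟨hw, p.concat hvw, ?_, ?_, ?_⟩
  · simpa using hp.length_le
  · rw [SimpleGraph.Walk.edges_concat, List.concat_eq_append, List.map_append]
    exact hp.nodup.append (by simp) (by simpa using hnew)
  · intro e he
    rw [SimpleGraph.Walk.edges_concat, List.concat_eq_append, List.mem_append,
      List.mem_singleton] at he
    rcases he with he | rfl
    · exact hA (hp.color_mem e he)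
    · exact hcA

theorem card_filter_mem_newColors_le (hκ : ProperOn G κ) (W : Finset V) (c : K) :
    #{w ∈ W | c ∈ newColors G κ H x A i w} ≤ #(reach G κ H x A i) := by
  calc #{w ∈ W | c ∈ newColors G κ H x A i w}
      ≤ #((reach G κ H x A i).biUnion fun v =>
          {w ∈ W | G.Adj v w ∧ κ s(v, w) ∈ ({c} : Finset K)}) := by
        refine card_le_card fun w hw => ?_
        obtain ⟨hwW, hc⟩ := mem_filter.1 hw
        obtain ⟨-, v, hv, p, hp, hvw, hvwc, -⟩ := mem_filter.1 hc
        exact mem_biUnion.2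
          ⟨v, mem_filter.2 ⟨hv, p, hp⟩, mem_filter.2 ⟨hwW, hvw, mem_singleton.2 hvwc⟩⟩
    _ ≤ #(reach G κ H x A i) * 1 :=
        card_biUnion_le_card_mul _ _ 1 fun v _ => hκ.card_filter_color_mem_le v W {c}
    _ = #(reach G κ H x A i) := mul_one _

theorem card_filter_notMem_newColors_le (hκ : ProperOn G κ) (W : Finset V) {v : V}
    (hv : v ∈ reach G κ H x A i) :
    #{w ∈ W | G.Adj v w ∧ κ s(v, w) ∉ newColors G κ H x A i w} ≤ i := by
  obtain ⟨hvH, p, hp⟩ := mem_filter.1 hv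
  calc #{w ∈ W | G.Adj v w ∧ κ s(v, w) ∉ newColors G κ H x A i w}
      ≤ #{w ∈ W | G.Adj v w ∧ κ s(v, w) ∈ (p.edges.map κ).toFinset} := by
        refine card_le_card (monotone_filter_right W fun w _ hw => ⟨hw.1, ?_⟩)
        by_contra hnew
        rw [List.mem_toFinset] at hnew
        exact hw.2 (mem_filter.2 ⟨mem_univ _, v, hvH, p, hp, hw.1, rfl, hnew⟩)
    _ ≤ #(p.edges.map κ).toFinset := hκ.card_filter_color_mem_le v W _
    _ ≤ p.length := (List.toFinset_card_le _).trans (by simp)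
    _ ≤ i := hp.length_le

theorem IsRobustExpander.many_newColors {η δ δ' : ℝ} (hH : IsRobustExpander G H η δ')
    (hκ : ProperOn G κ) (hx : x ∈ H) (hδ : δ + i ≤ δ') (hhalf : 2 * #(reach G κ H x A i) ≤ #H)
    (k : ℕ) :
    η * #(reach G κ H x A i) ≤
        #{w ∈ H \ reach G κ H x A i | k ≤ #(newColors G κ H x A i w)} ∨
      δ * #(reach G κ H x A i) ≤ ∑ w ∈ H \ reach G κ H x A i with #(newColors G κ H x A i w) < k,
        (#(newColors G κ H x A i w) : ℝ) := by
  set B := reach G κ H x A i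
  set T := newColors G κ H x A i
  let F₁ : Finset (V × V) := {p ∈ B ×ˢ (H \ B) | G.Adj p.1 p.2 ∧ κ s(p.1, p.2) ∉ T p.2}
  let F₂ : Finset (V × V) :=
    {p ∈ B ×ˢ {w ∈ H \ B | #(T w) < k} | G.Adj p.2 p.1 ∧ κ s(p.2, p.1) ∈ T p.2}
  by_cases hF : (#(F₁ ∪ F₂) : ℝ) ≤ δ' * #B
  · left
    refine (hH B (filter_subset _ _) ⟨x, self_mem_reach hx A i⟩ hhalf _ hF).trans ?_
    refine Nat.cast_le.2 (card_le_card fun w hw => ?_)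
    obtain ⟨hwHB, v, hv, hvw, hvwF⟩ := mem_filter.1 hw
    refine mem_filter.2 ⟨hwHB, ?_⟩
    by_contra! hlt
    have hwv := hvw.symm
    simp only [F₁, F₂, mem_union, mem_filter, mem_product, Sym2.eq_swap (a := w)] at hvwF
    tauto
  · right
    have hF₁ : (#F₁ : ℝ) ≤ i * #B :=
      card_filter_product_le_mul (fun v w => G.Adj v w ∧ κ s(v, w) ∉ T w) fun v hv => by
        exact_mod_cast card_filter_notMem_newColors_le hκ (H \ B) hv
    have hF₂ : #F₂ ≤ ∑ w ∈ H \ B with #(T w) < k, #(T w) := by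
      rw [card_filter, sum_product_right]
      refine sum_le_sum fun w _ => ?_
      rw [← card_filter]
      exact hκ.card_filter_color_mem_le w B (T w)
    have hF₂' : (#F₂ : ℝ) ≤ ∑ w ∈ H \ B with #(T w) < k, (#(T w) : ℝ) := by exact_mod_cast hF₂
    have hunion : (#(F₁ ∪ F₂) : ℝ) ≤ #F₁ + #F₂ := by exact_mod_cast card_union_le _ _
    linarith [mul_le_mul_of_nonneg_right hδ (Nat.cast_nonneg (α := ℝ) #B)]

theorem IsRobustExpander.prob_card_reach_succ_lt_le {m : ℕ} [NeZero m] {η δ δ' : ℝ}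
    (hH : IsRobustExpander G H η δ') (hκ : ProperOn G κ) (hx : x ∈ H) (hη : η ≤ 2)
    (hδ : δ + i ≤ δ') {k : ℕ} (hk : 0 < k) (hhalf : 2 * #(reach G κ H x A i) ≤ #H) :
    prob (fun u : K → Fin m => (#(reach G κ H x (A ∪ {c | u c = 0}) (i + 1)) : ℝ) <
        (1 + η / 2) * #(reach G κ H x A i)) ≤
      2 * Real.exp (-k / (2 * m)) + Real.exp (1 - δ / (2 * m * k)) := by
  have : Nonempty K := ⟨κ s(x, x)⟩
  set B := reach G κ H x A i
  refine (prob_mono fun u hu => ?_).trans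
    (prob_card_hit_lt_le (card_pos.2 ⟨x, self_mem_reach hx A i⟩) hk hη
      (card_filter_mem_newColors_le hκ (H \ B)) (hH.many_newColors hκ hx hδ hhalf k))
  set N : Finset V := {w ∈ H \ B | ∃ c ∈ newColors G κ H x A i w, u c = 0}
  have hsub : B ∪ N ⊆ reach G κ H x (A ∪ {c | u c = 0}) (i + 1) := by
    refine union_subset (reach_mono Set.subset_union_left i.le_succ) fun w hw => ?_
    obtain ⟨hwHB, c, hc, huc⟩ := mem_filter.1 hw
    exact mem_reach_succ_of_mem_newColors Set.subset_union_left (mem_sdiff.1 hwHB).1 hc (Or.inr huc)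
  have hdisj : Disjoint B N := disjoint_sdiff.mono_right (filter_subset _ _)
  have hcard : (#B + #N : ℝ) ≤ #(reach G κ H x (A ∪ {c | u c = 0}) (i + 1)) := by
    exact_mod_cast card_union_of_disjoint hdisj ▸ card_le_card hsub
  linarith

end Reach

/-! ### Sprinkling the colours in rounds -/

section Rounds

variable {V K : Type*} {G : SimpleGraph V} {κ : Sym2 V → K} {H : Finset V} {x : V} {l m : ℕ}
  [NeZero m]

/-- The colours revealed in the first `i` of `l` rounds, where round `j` reveals the colours `c`
with `g j c = 0`. -/
def exposed (g : Fin l → K → Fin m) (i : ℕ) : Set K := {c | ∃ j : Fin l, j < i ∧ g j c = 0}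

theorem exposed_update_self (g : Fin l → K → Fin m) (j : Fin l) (u : K → Fin m) :
    exposed (Function.update g j u) j = exposed g j := by
  ext c
  refine exists_congr fun i => and_congr_right fun hi => ?_
  rw [Function.update_of_ne (Fin.ne_of_lt hi)]

theorem exposed_update_succ (g : Fin l → K → Fin m) (j : Fin l) (u : K → Fin m) :
    exposed (Function.update g j u) (j + 1) = exposed g j ∪ {c | u c = 0} := by
  ext c
  constructor
  · rintro ⟨i, hi, hc⟩
    rcases (Nat.lt_succ_iff_lt_or_eq.1 hi) with hlt | heq
    · exact Or.inl ⟨i, hlt, by rwa [Function.update_of_ne (Fin.ne_of_lt hlt)] at hc⟩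
    · rw [Fin.val_inj] at heq
      exact Or.inr (by rwa [heq, Function.update_self] at hc)
  · rintro (⟨i, hi, hc⟩ | hc)
    · exact ⟨i, hi.trans j.val.lt_succ_self, by rwa [Function.update_of_ne (Fin.ne_of_lt hi)]⟩
    · exact ⟨j, j.val.lt_succ_self, by rwa [Function.update_self]⟩

theorem exposed_mono (g : Fin l → K → Fin m) : Monotone (exposed g) :=
  fun _ _ hij _ ⟨k, hk, hc⟩ => ⟨k, hk.trans_le hij, hc⟩

theorem exists_perm_disjoint_exposed (hlm : 2 * l ≤ m) :
    ∃ τ : Equiv.Perm (Fin l → K → Fin m), ∀ g, Disjoint (exposed g l) (exposed (τ g) l) := by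
  have hm : (0 : ℝ) < m := by exact_mod_cast NeZero.pos m
  have hcoord (j : Fin l) : prob (fun ω : Fin l → Fin m => ω j = 0) ≤ 1 / m := by
    refine prob_le_of_update j fun g => ?_
    simp [prob]
  have hhalf : prob (fun ω : Fin l → Fin m => ∃ j, ω j = 0) ≤ 1 / 2 := by
    calc prob (fun ω : Fin l → Fin m => ∃ j, ω j = 0) ≤ l * (1 / m) := by
          simpa only [Fintype.card_fin] using prob_exists_le_card_mul hcoord
      _ ≤ 1 / 2 := by
          have : (2 * l : ℝ) ≤ m := by exact_mod_cast hlm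
          rw [mul_one_div, div_le_div_iff₀ hm two_pos]
          linarith
  obtain ⟨σ, hσ⟩ := exists_perm_forall_not_of_prob_le_half hhalf
  let swap := Equiv.piComm fun (_ : Fin l) (_ : K) => Fin m
  refine ⟨swap.trans ((Equiv.piCongrRight fun _ => σ).trans swap.symm), fun g => ?_⟩
  refine Set.disjoint_left.2 fun c ⟨j, _, hj⟩ ⟨j', _, hj'⟩ => ?_
  exact hσ (swap g c) ⟨j, hj⟩ ⟨j', hj'⟩

variable [Fintype K]

theorem IsRobustExpander.prob_two_mul_card_reach_le {η δ δ' : ℝ} (hH : IsRobustExpander G H η δ')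
    (hκ : ProperOn G κ) (hx : x ∈ H) (hη0 : 0 ≤ η) (hη : η ≤ 2) (hδ : δ + l ≤ δ') {k : ℕ}
    (hk : 0 < k) (hcard : #H < (1 + η / 2) ^ l) :
    prob (fun g : Fin l → K → Fin m => 2 * #(reach G κ H x (exposed g l) l) ≤ #H) ≤
      l * (2 * Real.exp (-k / (2 * m)) + Real.exp (1 - δ / (2 * m * k))) := by
  let B (g : Fin l → K → Fin m) (i : ℕ) : Finset V := reach G κ H x (exposed g i) i
  have hB (g) : Monotone (B g) := fun i j hij => reach_mono (exposed_mono g hij) hij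
  have hstuck (g : Fin l → K → Fin m) (hg : 2 * #(B g l) ≤ #H) : ∃ j : Fin l,
      2 * #(B g j) ≤ #H ∧ (#(B g (j + 1)) : ℝ) < (1 + η / 2) * #(B g j) := by
    by_contra! hgrow
    have hgeom : (1 + η / 2) ^ l * #(B g 0) ≤ #(B g l) :=
      geom_le (u := fun i => (#(B g i) : ℝ)) (by positivity) l fun j hj => hgrow ⟨j, hj⟩
        ((Nat.mul_le_mul_left 2 (card_le_card (hB g hj.le))).trans hg)
    have hone : (1 : ℝ) ≤ #(B g 0) := by
      exact_mod_cast card_pos.2 ⟨x, self_mem_reach hx _ _⟩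
    have hle : (#(B g l) : ℝ) ≤ #H := by exact_mod_cast card_le_card (filter_subset _ _)
    linarith [le_mul_of_one_le_right (by positivity : 0 ≤ (1 + η / 2) ^ l) hone]
  have hround (j : Fin l) : prob (fun g : Fin l → K → Fin m =>
      2 * #(B g j) ≤ #H ∧ (#(B g (j + 1)) : ℝ) < (1 + η / 2) * #(B g j)) ≤
        2 * Real.exp (-k / (2 * m)) + Real.exp (1 - δ / (2 * m * k)) := by
    refine prob_le_of_update j fun g => ?_
    simp only [B, exposed_update_self, exposed_update_succ]
    by_cases hhalf : 2 * #(B g j) ≤ #H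
    · have hj : δ + (j : ℕ) ≤ δ' := by
        have : ((j : ℕ) : ℝ) ≤ l := by exact_mod_cast j.is_lt.le
        linarith
      exact (prob_mono fun u hu => hu.2).trans
        (hH.prob_card_reach_succ_lt_le hκ hx hη hj hk hhalf)
    · refine (prob_mono fun u hu => hhalf hu.1).trans ?_
      rw [prob_false]
      positivity
  calc prob (fun g : Fin l → K → Fin m => 2 * #(B g l) ≤ #H)
      ≤ prob fun g : Fin l → K → Fin m => ∃ j : Fin l,
          2 * #(B g j) ≤ #H ∧ (#(B g (j + 1)) : ℝ) < (1 + η / 2) * #(B g j) := prob_mono hstuck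
    _ ≤ l * (2 * Real.exp (-k / (2 * m)) + Real.exp (1 - δ / (2 * m * k))) := by
        simpa only [Fintype.card_fin] using prob_exists_le_card_mul hround

theorem IsRobustExpander.prob_two_mul_card_reach_lt_half {η δ : ℝ} (hH : IsRobustExpander G H η δ)
    (hκ : ProperOn G κ) (hx : x ∈ H) (hη0 : 0 ≤ η) (hη : η ≤ 2) (hl : 0 < l)
    (hδ : 1280 * (l : ℝ) ^ 4 + l ≤ δ) (hcard : #H < (1 + η / 2) ^ l) (hm : m = 2 * l) :
    prob (fun g : Fin l → K → Fin m => 2 * #(reach G κ H x (exposed g l) l) ≤ #H) < 1 / 2 := by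
  have : (1 : ℝ) ≤ l := by exact_mod_cast hl
  refine (hH.prob_two_mul_card_reach_le hκ hx hη0 hη hδ (k := 32 * l ^ 2) (by positivity)
    hcard).trans_lt ?_
  have hfirst : l * Real.exp (-(32 * l ^ 2 : ℕ) / (2 * m)) ≤ 1 / 8 := by
    have hexponent : -((32 * l ^ 2 : ℕ) : ℝ) / (2 * m) = -(8 * l) := by
      rw [hm]; push_cast; field_simp; norm_num
    rw [hexponent, Real.exp_neg, ← div_eq_mul_inv, div_le_iff₀ (Real.exp_pos _)]
    linarith [Real.add_one_le_exp (8 * l : ℝ)]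
  have hsecond : l * Real.exp (1 - 1280 * (l : ℝ) ^ 4 / (2 * m * (32 * l ^ 2 : ℕ))) ≤ 1 / 10 := by
    have hexponent : 1 - 1280 * (l : ℝ) ^ 4 / (2 * m * (32 * l ^ 2 : ℕ)) = -(10 * l - 1) := by
      rw [hm]; push_cast; field_simp; ring
    rw [hexponent, Real.exp_neg, ← div_eq_mul_inv, div_le_iff₀ (Real.exp_pos _)]
    linarith [Real.add_one_le_exp (10 * l - 1 : ℝ)]
  linarith

end Rounds

/-! ### Rainbow linkages -/

section Linkage

variable {V K : Type*} {G : SimpleGraph V} {κ : Sym2 V → K} {x y z : V}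

theorem IsRainbowWalk.reverse {A : Set K} {i : ℕ} {p : G.Walk x y} (hp : IsRainbowWalk κ A i p) :
    IsRainbowWalk κ A i p.reverse where
  length_le := by simpa using hp.length_le
  nodup := by
    rw [SimpleGraph.Walk.edges_reverse, List.map_reverse]
    exact List.nodup_reverse.2 hp.nodup
  color_mem e he := hp.color_mem e (by simpa using he)

theorem IsRainbowWalk.append {A B : Set K} {i j : ℕ} {p : G.Walk x y} {q : G.Walk y z}
    (hp : IsRainbowWalk κ A i p) (hq : IsRainbowWalk κ B j q) (hAB : Disjoint A B) :
    IsRainbowWalk κ (A ∪ B) (i + j) (p.append q) where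
  length_le := by
    rw [SimpleGraph.Walk.length_append]
    exact add_le_add hp.length_le hq.length_le
  nodup := by
    rw [SimpleGraph.Walk.edges_append, List.map_append]
    refine hp.nodup.append hq.nodup fun c hcp hcq => ?_
    obtain ⟨e, he, rfl⟩ := List.mem_map.1 hcp
    obtain ⟨f, hf, hfe⟩ := List.mem_map.1 hcq
    exact Set.disjoint_left.1 hAB (hp.color_mem e he) (hfe ▸ hq.color_mem f hf)
  color_mem e he := by
    rw [SimpleGraph.Walk.edges_append, List.mem_append] at he
    exact he.imp (hp.color_mem e) (hq.color_mem e)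

theorem IsRainbowWalk.bypass {A : Set K} {i : ℕ} {p : G.Walk x y} (hp : IsRainbowWalk κ A i p) :
    IsRainbowWalk κ A i p.bypass where
  length_le := p.length_bypass_le_length.trans hp.length_le
  nodup := hp.nodup.sublist (p.edges_bypass_sublist_edges.map κ)
  color_mem e he := hp.color_mem e (p.edges_bypass_subset_edges he)

variable {H : Finset V} {η δ : ℝ} {l : ℕ}

theorem IsRobustExpander.exists_isPath_isRainbowWalk [Finite K] (hH : IsRobustExpander G H η δ)
    (hκ : ProperOn G κ) (hx : x ∈ H) (hy : y ∈ H) (hη0 : 0 ≤ η) (hη : η ≤ 2) (hl : 0 < l)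
    (hδ : 1280 * (l : ℝ) ^ 4 + l ≤ δ) (hcard : #H < (1 + η / 2) ^ l) :
    ∃ p : G.Walk x y, p.IsPath ∧ IsRainbowWalk κ Set.univ (2 * l) p := by
  have := Fintype.ofFinite K
  have : NeZero (2 * l) := ⟨by positivity⟩
  obtain ⟨τ, hτ⟩ := exists_perm_disjoint_exposed (K := K) (le_refl (2 * l))
  have hreach {v : V} (hv : v ∈ H) :
      prob (fun g : Fin l → K → Fin (2 * l) => 2 * #(reach G κ H v (exposed g l) l) ≤ #H) <
        1 / 2 := hH.prob_two_mul_card_reach_lt_half hκ hv hη0 hη hl hδ hcard rfl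
  obtain ⟨g, hgx, hgy⟩ := exists_not_and_not_of_prob_lt_half (hreach hx)
    ((prob_comp_equiv τ _).trans_lt (hreach hy))
  obtain ⟨v, hv⟩ : (reach G κ H x (exposed g l) l ∩
      reach G κ H y (exposed (τ g) l) l).Nonempty :=
    inter_nonempty_of_card_lt_card_add_card (filter_subset _ _) (filter_subset _ _) (by omega)
  obtain ⟨hvx, hvy⟩ := mem_inter.1 hv
  obtain ⟨-, p, hp⟩ := mem_filter.1 hvx
  obtain ⟨-, q, hq⟩ := mem_filter.1 hvy
  exact ⟨(p.append q.reverse).bypass, SimpleGraph.Walk.bypass_isPath _,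
    (hp.append hq.reverse (hτ g)).bypass.mono (Set.subset_univ _) (two_mul l).ge⟩

theorem IsRobustExpander.deleteEdges (hH : IsRobustExpander G H η δ) (hκ : ProperOn G κ)
    (U : Finset V) (C : Finset K) :
    IsRobustExpander (G.deleteEdges {e | κ e ∈ C ∨ ∃ v ∈ U, v ∈ e}) (H \ U) η (δ - (#U + #C)) := by
  refine hH.of_card_deleted_le sdiff_subset fun v hv => ?_
  have hle : #(U ∪ {w ∈ H | G.Adj v w ∧ κ s(v, w) ∈ C}) ≤ #U + #C :=
    (card_union_le _ _).trans (Nat.add_le_add_left (hκ.card_filter_color_mem_le v H C) _)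
  refine (Nat.cast_le.2 (card_le_card fun w hw => ?_)).trans (by exact_mod_cast hle)
  obtain ⟨hwH, hvw, hdeleted⟩ := by simpa only [mem_filter] using hw
  by_cases hwU : w ∈ U
  · exact mem_union_left _ hwU
  · refine mem_union_right _ (mem_filter.2 ⟨hwH, hvw, ?_⟩)
    by_contra hC
    refine hdeleted ⟨SimpleGraph.deleteEdges_adj.2 ⟨hvw, ?_⟩, mem_sdiff.2 ⟨hwH, hwU⟩⟩
    rintro (hC' | ⟨u, hu, huvw⟩)
    · exact hC hC'
    · rcases Sym2.mem_iff.1 huvw with rfl | rfl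
      exacts [(mem_sdiff.1 hv).2 hu, hwU hu]

theorem IsRobustExpander.exists_isPath_avoiding [Finite K] (hH : IsRobustExpander G H η δ)
    (hκ : ProperOn G κ) (hx : x ∈ H) (hy : y ∈ H) (hη0 : 0 ≤ η) (hη : η ≤ 2) (hl : 0 < l)
    {U : Finset V} {C : Finset K} (hxU : x ∉ U) (hyU : y ∉ U)
    (hδ : 1280 * (l : ℝ) ^ 4 + l + #U + #C ≤ δ) (hcard : #H < (1 + η / 2) ^ l) :
    ∃ p : G.Walk x y, p.IsPath ∧ IsRainbowWalk κ (C : Set K)ᶜ (2 * l) p ∧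
      ∀ w ∈ p.support, w ∉ U := by
  set G' := G.deleteEdges {e | κ e ∈ C ∨ ∃ v ∈ U, v ∈ e}
  have hG' : G' ≤ G := G.deleteEdges_le _
  have hκ' : ProperOn G' κ := fun a b c hab hac => hκ (hG' hab) (hG' hac)
  have hcard' : (#(H \ U) : ℝ) < (1 + η / 2) ^ l :=
    lt_of_le_of_lt (by exact_mod_cast card_le_card sdiff_subset) hcard
  obtain ⟨p, hpath, hp⟩ := (hH.deleteEdges hκ U C).exists_isPath_isRainbowWalk hκ'
    (mem_sdiff.2 ⟨hx, hxU⟩) (mem_sdiff.2 ⟨hy, hyU⟩) hη0 hη hl (by linarith) hcard'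
  have hedge (e : Sym2 V) (he : e ∈ p.edges) : κ e ∉ C ∧ ∀ v ∈ U, v ∉ e := by
    have := p.edges_subset_edgeSet he
    simp only [SimpleGraph.edgeSet_deleteEdges, Set.mem_sdiff, Set.mem_ofPred_eq] at this
    push Not at this
    exact this.2
  refine ⟨p.mapLe hG', hpath.mapLe hG', ⟨?_, ?_, ?_⟩, fun w hw hwU => ?_⟩
  · simpa using hp.length_le
  · simpa only [SimpleGraph.Walk.edges_mapLe_eq_edges] using hp.nodup
  · intro e he
    rw [SimpleGraph.Walk.edges_mapLe_eq_edges] at he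
    exact (hedge e he).1
  · rw [SimpleGraph.Walk.support_mapLe_eq_support,
      SimpleGraph.Walk.mem_support_iff_exists_mem_edges] at hw
    rcases hw with rfl | ⟨e, he, hwe⟩
    · exact hyU hwU
    · exact (hedge e he).2 w hwU hwe

/-- The walk `p` is a rainbow path of length at most `m`, none of whose inner vertices lies in
`B`. -/
structure IsLink (κ : Sym2 V → K) (B : Set V) (m : ℕ) (p : G.Walk x y) : Prop where
  isPath : p.IsPath
  isRainbowWalk : IsRainbowWalk κ Set.univ m p
  eq_or_eq : ∀ v ∈ p.support, v ∈ B → v = x ∨ v = y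

/-- The walks `p` and `q` share no vertices outside `B`, and no colours. -/
def AreIndependent (κ : Sym2 V → K) (B : Set V) {x' y' : V} (p : G.Walk x y) (q : G.Walk x' y') :
    Prop :=
  (∀ v ∈ p.support, v ∈ q.support → v ∈ B) ∧ ∀ e ∈ p.edges, ∀ f ∈ q.edges, κ e ≠ κ f

theorem AreIndependent.symm {B : Set V} {x' y' : V} {p : G.Walk x y} {q : G.Walk x' y'}
    (h : AreIndependent κ B p q) : AreIndependent κ B q p :=
  ⟨fun v hvq hvp => h.1 v hvp hvq, fun f hf e he => (h.2 e he f hf).symm⟩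

theorem exists_forall_pairwise_of_forall_exists {ι : Type*} [Finite ι] {β : ι → Type*}
    [∀ i, Nonempty (β i)] {R : ∀ ⦃i j : ι⦄, β i → β j → Prop}
    (hsymm : ∀ ⦃i j : ι⦄ ⦃a : β i⦄ ⦃b : β j⦄, R a b → R b a)
    (hext : ∀ (f : ∀ i, β i) (i : ι), ∃ a : β i, ∀ j, R a (f j)) :
    ∃ f : ∀ i, β i, ∀ i j, i ≠ j → R (f i) (f j) := by
  have := Fintype.ofFinite ι
  suffices ∀ s : Finset ι, ∃ f : ∀ i, β i, ∀ i ∈ s, ∀ j ∈ s, i ≠ j → R (f i) (f j) by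
    simpa using this univ
  intro s
  induction s using Finset.induction_on with
  | empty => exact ⟨fun i => Classical.arbitrary (β i), by simp⟩
  | insert k s hk ih =>
    obtain ⟨f, hf⟩ := ih
    obtain ⟨a, ha⟩ := hext f k
    have hne {i : ι} (hi : i ∈ s) : i ≠ k := fun h => hk (h ▸ hi)
    refine ⟨Function.update f k a, fun i hi j hj hij => ?_⟩
    rcases mem_insert.1 hi with rfl | his <;> rcases mem_insert.1 hj with rfl | hjs
    · exact absurd rfl hij
    · rw [Function.update_self, Function.update_of_ne (hne hjs)]
      exact ha j
    · rw [Function.update_self, Function.update_of_ne (hne his)]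
      exact hsymm (ha i)
    · rw [Function.update_of_ne (hne his), Function.update_of_ne (hne hjs)]
      exact hf i his j hjs hij

variable [Finite K] {B : Finset V} {ι : Type*} [Fintype ι] {a b : ι → V}

theorem IsRobustExpander.exists_isLink_forall_areIndependent (hH : IsRobustExpander G H η δ)
    (hκ : ProperOn G κ) (hBH : B ⊆ H) (hη0 : 0 ≤ η) (hη : η ≤ 2) (hl : 0 < l)
    (hδ : 1280 * (l : ℝ) ^ 4 + l + #B + Fintype.card ι * (4 * l + 1) ≤ δ)
    (hcard : #H < (1 + η / 2) ^ l) (hx : x ∈ B) (hy : y ∈ B) (P : ∀ i, G.Walk (a i) (b i))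
    (hP : ∀ i, (P i).length ≤ 2 * l) :
    ∃ p : G.Walk x y, IsLink κ B (2 * l) p ∧ ∀ i, AreIndependent κ B p (P i) := by
  let U : Finset V := (B ∪ univ.biUnion fun i => (P i).support.toFinset) \ {x, y}
  let C : Finset K := univ.biUnion fun i => ((P i).edges.map κ).toFinset
  have hU : #U ≤ #B + Fintype.card ι * (2 * l + 1) := by
    refine (card_le_card sdiff_subset).trans ((card_union_le _ _).trans (Nat.add_le_add_left ?_ _))
    refine card_biUnion_le_card_mul _ _ _ fun i _ => (List.toFinset_card_le _).trans ?_
    simpa using hP i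
  have hC : #C ≤ Fintype.card ι * (2 * l) := by
    refine card_biUnion_le_card_mul _ _ _ fun i _ => (List.toFinset_card_le _).trans ?_
    simpa using hP i
  have hUC : (#U : ℝ) + #C ≤ #B + Fintype.card ι * (4 * l + 1) := by
    have : #U + #C ≤ #B + Fintype.card ι * (4 * l + 1) := by linarith
    exact_mod_cast this
  obtain ⟨p, hpath, hp, hpU⟩ := hH.exists_isPath_avoiding hκ (hBH hx) (hBH hy) hη0 hη hl
    (U := U) (C := C) (by simp [U]) (by simp [U]) (by linarith) hcard
  have hends {v : V} (hv : v ∈ p.support)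
      (hvU : v ∈ B ∪ univ.biUnion fun i => (P i).support.toFinset) : v = x ∨ v = y := by
    by_contra hne
    exact hpU v hv (mem_sdiff.2 ⟨hvU, by simpa using hne⟩)
  refine ⟨p, ⟨hpath, hp.mono (Set.subset_univ _) le_rfl, fun v hv hvB =>
    hends hv (mem_union_left _ hvB)⟩, fun i => ⟨fun v hv hvi => ?_, fun e he f hf hef => ?_⟩⟩
  · rcases hends hv (mem_union_right _ (mem_biUnion.2
      ⟨i, mem_univ i, List.mem_toFinset.2 hvi⟩)) with rfl | rfl
    exacts [hx, hy]
  · exact hp.color_mem e he (mem_biUnion.2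
      ⟨i, mem_univ i, List.mem_toFinset.2 (hef ▸ List.mem_map_of_mem hf)⟩)

theorem IsRobustExpander.exists_isLink_pairwise_areIndependent (hH : IsRobustExpander G H η δ)
    (hκ : ProperOn G κ) (hBH : B ⊆ H) (hη0 : 0 ≤ η) (hη : η ≤ 2) (hl : 0 < l)
    (hδ : 1280 * (l : ℝ) ^ 4 + l + #B + Fintype.card ι * (4 * l + 1) ≤ δ)
    (hcard : #H < (1 + η / 2) ^ l) (ha : ∀ i, a i ∈ B) (hb : ∀ i, b i ∈ B) :
    ∃ P : ∀ i, G.Walk (a i) (b i), (∀ i, IsLink κ B (2 * l) (P i)) ∧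
      ∀ i j, i ≠ j → AreIndependent κ B (P i) (P j) := by
  let Link (i : ι) := {p : G.Walk (a i) (b i) // IsLink κ B (2 * l) p}
  have (i : ι) : Nonempty (Link i) := by
    have hδ' : 1280 * (l : ℝ) ^ 4 + l + #B + Fintype.card Empty * (4 * l + 1) ≤ δ := by
      refine le_trans ?_ hδ
      gcongr
      simp
    obtain ⟨p, hp, -⟩ := hH.exists_isLink_forall_areIndependent (a := Empty.elim)
      (b := Empty.elim) hκ hBH hη0 hη hl hδ' hcard (ha i) (hb i) (fun i => i.elim) (fun i => i.elim)
    exact ⟨p, hp⟩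
  obtain ⟨P, hP⟩ := exists_forall_pairwise_of_forall_exists (β := Link)
    (R := fun _ _ p q => AreIndependent κ B p.1 q.1) (fun _ _ _ _ h => h.symm) fun P i => by
      obtain ⟨p, hp, hpP⟩ := hH.exists_isLink_forall_areIndependent hκ hBH hη0 hη hl hδ hcard
        (ha i) (hb i) (fun j => (P j).1) fun j => (P j).2.isRainbowWalk.length_le
      exact ⟨⟨p, hp⟩, hpP⟩
  exact ⟨fun i => (P i).1, fun i => (P i).2, hP⟩

end Linkage

/-! ### Subdivisions of cliques -/

section Subdivision

variable {V K : Type*} {G : SimpleGraph V} {κ : Sym2 V → K} {t : ℕ}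

theorem CliqueSubdivision.exists_mem_edges_path (D : CliqueSubdivision G t) {e : Sym2 V}
    (he : e ∈ D.toSubgraph.edgeSet) :
    ∃ (i j : Fin t) (h : i < j), e ∈ (D.path i j h : G.Walk (D.branch i) (D.branch j)).edges := by
  simpa [CliqueSubdivision.toSubgraph, SimpleGraph.Subgraph.edgeSet_sup,
    SimpleGraph.Subgraph.edgeSet_iSup] using he

theorem exists_cliqueSubdivision_of_isLink {m : ℕ} (b : Fin t ↪ V)
    (P : ∀ p : {p : Fin t × Fin t // p.1 < p.2}, G.Walk (b p.1.1) (b p.1.2))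
    (hP : ∀ p, IsLink κ (Set.range b) m (P p))
    (hPP : ∀ p q, p ≠ q → AreIndependent κ (Set.range b) (P p) (P q)) :
    ∃ D : CliqueSubdivision G t, Set.InjOn κ D.toSubgraph.edgeSet ∧
      ∀ (i j : Fin t) (h : i < j),
        (D.path i j h : G.Walk (D.branch i) (D.branch j)).length ≤ m := by
  let D : CliqueSubdivision G t :=
    { branch := b
      path := fun i j h => ⟨P ⟨(i, j), h⟩, (hP _).isPath⟩
      branch_mem := fun i j h k hk =>
        ((hP ⟨(i, j), h⟩).eq_or_eq _ hk ⟨k, rfl⟩).imp (fun h => b.injective h)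
          fun h => b.injective h
      disjoint := fun i j h k l h' hne => (hPP ⟨(i, j), h⟩ ⟨(k, l), h'⟩ (by simpa using hne)).1 }
  refine ⟨D, fun e he f hf hef => ?_, fun i j h => (hP _).isRainbowWalk.length_le⟩
  obtain ⟨i, j, h, he⟩ := D.exists_mem_edges_path he
  obtain ⟨k, l, h', hf⟩ := D.exists_mem_edges_path hf
  by_cases hpair : (⟨(i, j), h⟩ : {p : Fin t × Fin t // p.1 < p.2}) = ⟨(k, l), h'⟩
  · obtain ⟨rfl, rfl⟩ := Prod.mk.inj (Subtype.mk.inj hpair)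
    exact List.inj_on_of_nodup_map (hP ⟨(i, j), h⟩).isRainbowWalk.nodup he hf hef
  · exact absurd hef ((hPP _ _ hpair).2 e he f hf)

theorem IsRobustExpander.exists_cliqueSubdivision [Finite K] {H : Finset V} {η δ : ℝ} {l : ℕ}
    (hH : IsRobustExpander G H η δ) (hκ : ProperOn G κ) (hη0 : 0 ≤ η) (hη : η ≤ 2) (hl : 0 < l)
    (hδ : 1280 * (l : ℝ) ^ 4 + l + t + t ^ 2 * (4 * l + 1) ≤ δ) (hcard : #H < (1 + η / 2) ^ l)
    (htH : t ≤ #H) :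
    ∃ D : CliqueSubdivision G t, Set.InjOn κ D.toSubgraph.edgeSet ∧
      ∀ (i j : Fin t) (h : i < j),
        (D.path i j h : G.Walk (D.branch i) (D.branch j)).length ≤ 2 * l := by
  obtain ⟨B, hBH, hBt⟩ := exists_subset_card_eq htH
  let b : Fin t ↪ V :=
    (B.equivFinOfCardEq hBt).symm.toEmbedding.trans (Function.Embedding.subtype _)
  have hb : Set.range b = B :=
    ((B.equivFinOfCardEq hBt).symm.surjective.range_comp Subtype.val).trans Subtype.range_coe
  have hmem (i : Fin t) : b i ∈ B := mem_coe.1 (hb ▸ Set.mem_range_self i)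
  have hpairs : (Fintype.card {p : Fin t × Fin t // p.1 < p.2} : ℝ) ≤ t ^ 2 := by
    have := Fintype.card_subtype_le fun p : Fin t × Fin t => p.1 < p.2
    rw [Fintype.card_prod, Fintype.card_fin, ← sq] at this
    exact_mod_cast this
  obtain ⟨P, hP, hPP⟩ := hH.exists_isLink_pairwise_areIndependent hκ hBH hη0 hη hl (le_trans (by
      rw [hBt]; gcongr) hδ) hcard (a := fun p : {p : Fin t × Fin t // p.1 < p.2} => b p.1.1)
    (b := fun p => b p.1.2) (fun _ => hmem _) fun _ => hmem _
  rw [← hb] at hP hPP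
  exact exists_cliqueSubdivision_of_isLink b P hP hPP

theorem exp_le_one_add_pow {a : ℝ} (ha : 1 ≤ a) {l : ℕ} (hl : 13 * a ^ 2 ≤ l) :
    Real.exp a ≤ (1 + 1 / (12 * a)) ^ l := by
  have : 0 < a := one_pos.trans_le ha
  have hlog : 2 / (1 + 24 * a) ≤ Real.log (1 + 1 / (12 * a)) := by
    convert Real.le_log_one_add_of_nonneg (by positivity : 0 ≤ 1 / (12 * a)) using 1
    field_simp
    ring
  have hle : a ≤ l * Real.log (1 + 1 / (12 * a)) := by
    calc a ≤ 13 * a ^ 2 * (2 / (1 + 24 * a)) := by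
          rw [← mul_div_assoc, le_div_iff₀ (by positivity)]
          nlinarith
      _ ≤ l * Real.log (1 + 1 / (12 * a)) := by gcongr
  rwa [← Real.log_pow, Real.le_log_iff_exp_le (by positivity)] at hle

theorem le_div_of_le_mul_log_pow {t l L d : ℝ} (ht : 1 ≤ t) (hl : 1 ≤ l) (hL : 1 ≤ L)
    (hlL : l ≤ 60 * L ^ 2) (hd : 10 ^ 12 * t ^ 2 * L ^ 9 ≤ d) :
    1280 * l ^ 4 + l + t + t ^ 2 * (4 * l + 1) ≤ d / (12 * (1 + L)) := by
  have ht2 : 1 ≤ t ^ 2 := one_le_pow₀ ht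
  have hl4 : 1 ≤ l ^ 4 := one_le_pow₀ hl
  have hll : l ≤ l ^ 4 := le_self_pow₀ hl (by norm_num)
  have htt : t ≤ t ^ 2 := le_self_pow₀ ht (by norm_num)
  have hpoly : 1280 * l ^ 4 + l + t + t ^ 2 * (4 * l + 1) ≤ 1287 * (t ^ 2 * l ^ 4) := by
    linarith [le_mul_of_one_le_left (by positivity : 0 ≤ l ^ 4) ht2,
      le_mul_of_one_le_right (by positivity : 0 ≤ t ^ 2) hl4,
      mul_le_mul_of_nonneg_left hll (by positivity : 0 ≤ t ^ 2)]
  rw [le_div_iff₀ (by positivity)]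
  calc (1280 * l ^ 4 + l + t + t ^ 2 * (4 * l + 1)) * (12 * (1 + L))
      ≤ 1287 * (t ^ 2 * l ^ 4) * (12 * (L + L)) := by gcongr
    _ ≤ 1287 * (t ^ 2 * (60 * L ^ 2) ^ 4) * (12 * (L + L)) := by gcongr
    _ = 1287 * 60 ^ 4 * 24 * (t ^ 2 * L ^ 9) := by ring
    _ ≤ 10 ^ 12 * (t ^ 2 * L ^ 9) := by gcongr; norm_num
    _ ≤ d := by linarith

theorem IsRobustExpander.exists_cliqueSubdivision_of_sq_log_le [Finite K] {H : Finset V} {δ : ℝ}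
    {l : ℕ} (hH : IsRobustExpander G H (1 / (6 * (1 + Real.log #H))) δ) (hκ : ProperOn G κ)
    (hl : 13 * (1 + Real.log #H) ^ 2 ≤ l)
    (hδ : 1280 * (l : ℝ) ^ 4 + l + t + t ^ 2 * (4 * l + 1) ≤ δ) (htH : t ≤ #H) :
    ∃ D : CliqueSubdivision G t, Set.InjOn κ D.toSubgraph.edgeSet ∧
      ∀ (i j : Fin t) (h : i < j),
        (D.path i j h : G.Walk (D.branch i) (D.branch j)).length ≤ 2 * l := by
  have ha : 1 ≤ 1 + Real.log #H := le_add_of_nonneg_right (Real.log_natCast_nonneg _)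
  have hη : 1 / (6 * (1 + Real.log #H)) ≤ 2 := by
    rw [div_le_iff₀ (by positivity)]
    linarith
  have hl0 : (0 : ℝ) < l := lt_of_lt_of_le (by positivity) hl
  have hcard : (#H : ℝ) < (1 + 1 / (6 * (1 + Real.log #H)) / 2) ^ l := by
    calc (#H : ℝ) ≤ Real.exp (Real.log #H) := Real.le_exp_log _
      _ < Real.exp (1 + Real.log #H) := Real.exp_lt_exp.2 (lt_one_add _)
      _ ≤ (1 + 1 / (12 * (1 + Real.log #H))) ^ l := exp_le_one_add_pow ha hl
      _ = (1 + 1 / (6 * (1 + Real.log #H)) / 2) ^ l := by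
          rw [div_div, mul_right_comm]
          norm_num
  exact hH.exists_cliqueSubdivision hκ (by positivity) hη (by exact_mod_cast hl0) hδ hcard htH

variable [Fintype V]

theorem one_le_log_card_of_le_avgDegree [Nontrivial V]
    (hG : 2 ^ 11 * Real.log (Fintype.card V) ^ 9 ≤ avgDegree G univ) :
    1 ≤ Real.log (Fintype.card V) := by
  have htwo : (2 : ℝ) ≤ Fintype.card V := by exact_mod_cast Fintype.one_lt_card
  have hhalf : 1 / 2 ≤ Real.log (Fintype.card V) := by
    linarith [Real.log_le_log two_pos htwo, Real.log_two_gt_d9]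
  have hcard := avgDegree_le_card G univ
  rw [card_univ] at hcard
  have hfour : (4 : ℝ) ≤ Fintype.card V := by
    calc (4 : ℝ) = 2 ^ 11 * (1 / 2) ^ 9 := by norm_num
      _ ≤ 2 ^ 11 * Real.log (Fintype.card V) ^ 9 := by gcongr
      _ ≤ Fintype.card V := hG.trans hcard
  rw [Real.le_log_iff_exp_le (by positivity)]
  linarith [Real.exp_one_lt_d9]

theorem exists_cliqueSubdivision_of_le_avgDegree [Nontrivial V] [Finite K] (hκ : ProperOn G κ)
    (ht : 0 < t) (hG : 10 ^ 12 * t ^ 2 * Real.log (Fintype.card V) ^ 9 ≤ avgDegree G univ) :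
    ∃ D : CliqueSubdivision G t, Set.InjOn κ D.toSubgraph.edgeSet ∧
      ∀ (i j : Fin t) (h : i < j),
        ((D.path i j h : G.Walk (D.branch i) (D.branch j)).length : ℝ) ≤
          120 * Real.log (Fintype.card V) ^ 2 := by
  have ht1 : (1 : ℝ) ≤ t := by exact_mod_cast ht
  have hlog : 1 ≤ Real.log (Fintype.card V) := by
    refine one_le_log_card_of_le_avgDegree (le_trans ?_ hG)
    have := Real.log_natCast_nonneg (Fintype.card V)
    gcongr
    nlinarith
  set d := avgDegree G univ
  set L := Real.log (Fintype.card V)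
  have hd : 0 < d := lt_of_lt_of_le (by positivity) hG
  obtain ⟨H, hHne, hdH, hH⟩ := exists_isRobustExpander G hd le_rfl
  have hHL : Real.log #H ≤ L :=
    Real.log_le_log (by exact_mod_cast hHne.card_pos) (by exact_mod_cast card_le_univ H)
  have : 0 ≤ 1 + Real.log #H := (one_add_log_card_pos H).le
  set l := ⌈13 * (1 + L) ^ 2⌉₊
  have hl : 13 * (1 + L) ^ 2 ≤ l := Nat.le_ceil _
  have hlL : (l : ℝ) ≤ 60 * L ^ 2 := by
    have := Nat.ceil_lt_add_one (by positivity : 0 ≤ 13 * (1 + L) ^ 2)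
    nlinarith
  have hδ := le_div_of_le_mul_log_pow ht1 (by nlinarith : (1 : ℝ) ≤ l) hlog hlL hG
  have htH : (t : ℝ) ≤ #H := by
    calc (t : ℝ) ≤ 1280 * (l : ℝ) ^ 4 + l + t + t ^ 2 * (4 * l + 1) := by
          have : (0 : ℝ) ≤ 1280 * (l : ℝ) ^ 4 + l + t ^ 2 * (4 * l + 1) := by positivity
          linarith
      _ ≤ d / (12 * (1 + L)) := hδ
      _ ≤ d / (1 + L) := by gcongr; linarith
      _ ≤ #H := hdH
  obtain ⟨D, hD, hlength⟩ := hH.exists_cliqueSubdivision_of_sq_log_le hκ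
    (le_trans (by gcongr) hl) hδ (by exact_mod_cast htH)
  refine ⟨D, hD, fun i j h => ?_⟩
  calc ((D.path i j h : G.Walk (D.branch i) (D.branch j)).length : ℝ) ≤ 2 * l := by
        exact_mod_cast hlength i j h
    _ ≤ 120 * L ^ 2 := by linarith

end Subdivision

theorem IsProper.exists_properOn {V : Type u} {C : Type v} [Finite V] {G : SimpleGraph V}
    {χ : G.EdgeLabeling C} (hχ : IsProper χ) :
    ∃ (K : Type v) (_ : Finite K) (κ : Sym2 V → K), ProperOn G κ ∧
      ∀ e f : G.edgeSet, χ e = χ f → κ e = κ f := by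
  let χ' (e : Sym2 V) : Option C := if he : e ∈ G.edgeSet then some (χ ⟨e, he⟩) else none
  have hχ' (e : G.edgeSet) : χ' e = some (χ e) := dif_pos e.2
  have hκ {e f : Sym2 V} : Set.rangeFactorization χ' e = Set.rangeFactorization χ' f ↔
      χ' e = χ' f := Subtype.ext_iff
  refine ⟨Set.range χ', inferInstance, Set.rangeFactorization χ', fun a b c hab hac h => ?_,
    fun e f h => hκ.2 (by rw [hχ', hχ', h])⟩
  by_contra hbc
  refine hχ ⟨s(a, b), hab⟩ ⟨s(a, c), hac⟩ ?_ ⟨a, by simp, by simp⟩ ?_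
  · exact fun h => hbc (Sym2.congr_right.1 (congrArg Subtype.val h))
  · exact Option.some.inj ((hχ' _).symm.trans ((hκ.1 h).trans (hχ' ⟨s(a, c), hac⟩)))

theorem exists_mul_pow_le_exp_mul_sqrt (a : ℝ) {k : ℕ} (hk : k ≠ 0) :
    ∃ c : ℝ, 0 < c ∧ ∀ x : ℝ, 0 ≤ x → a * x ^ k ≤ Real.exp (c * √x) := by
  set N : ℝ := ((Nat.factorial (2 * k) : ℕ) : ℝ)
  have hN : 0 < N := Nat.cast_pos.2 (Nat.factorial_pos _)
  refine ⟨1 + |a| * N, by positivity, fun x hx => ?_⟩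
  have hc : a * N ≤ (1 + |a| * N) ^ (2 * k) := by
    calc a * N ≤ 1 + |a| * N := by nlinarith [le_abs_self a]
      _ ≤ (1 + |a| * N) ^ (2 * k) :=
          le_self_pow₀ (le_add_of_nonneg_right (by positivity)) (by positivity)
  calc a * x ^ k ≤ (1 + |a| * N) ^ (2 * k) * x ^ k / N := by
        rw [le_div_iff₀ hN, mul_right_comm]
        gcongr
    _ = ((1 + |a| * N) * √x) ^ (2 * k) / N := by
        rw [mul_pow, pow_mul √x, Real.sq_sqrt hx]
    _ ≤ Real.exp ((1 + |a| * N) * √x) := Real.pow_div_factorial_le_exp _ (by positivity) _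

theorem exists_mul_log_pow_mul_le_mul_exp (a : ℝ) {k : ℕ} (hk : k ≠ 0) :
    ∃ c : ℝ, 0 < c ∧ ∀ n : ℕ, a * Real.log n ^ k * n ≤ n * Real.exp (c * √(Real.log n)) := by
  obtain ⟨c, hc, hexp⟩ := exists_mul_pow_le_exp_mul_sqrt a hk
  refine ⟨c, hc, fun n => ?_⟩
  rw [mul_comm (n : ℝ)]
  exact mul_le_mul_of_nonneg_right (hexp _ (Real.log_natCast_nonneg n)) n.cast_nonneg

end RainbowSubdivision

open RainbowSubdivision

theorem theorem1_general {V : Type u} [Fintype V] [Nontrivial V] {C : Type v} {G : SimpleGraph V}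
    {χ : G.EdgeLabeling C} {t : ℕ} (ht : 0 < t) (hχ : IsProper χ)
    (hG : 10 ^ 12 * t ^ 2 * Real.log (Fintype.card V) ^ 9 * Fintype.card V ≤
      (G.edgeSet.ncard : ℝ)) :
    ∃ D : CliqueSubdivision G t, IsRainbow χ D.toSubgraph ∧
      ∀ (i j : Fin t) (h : i < j),
        ((D.path i j h : G.Walk (D.branch i) (D.branch j)).length : ℝ) ≤
          120 * Real.log (Fintype.card V) ^ 2 := by
  obtain ⟨K, _, κ, hκ, hχκ⟩ := hχ.exists_properOn
  have hn : (0 : ℝ) < Fintype.card V := Nat.cast_pos.2 Fintype.card_pos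
  have hdegree : 10 ^ 12 * t ^ 2 * Real.log (Fintype.card V) ^ 9 ≤ avgDegree G Finset.univ := by
    refine le_of_mul_le_mul_right (hG.trans ?_) hn
    linarith [avgDegree_univ_mul_card G, Nat.cast_nonneg (α := ℝ) G.edgeSet.ncard]
  obtain ⟨D, hD, hlength⟩ := exists_cliqueSubdivision_of_le_avgDegree hκ ht hdegree
  exact ⟨D, fun e f he hf hef => Subtype.ext (hD he hf (hχκ e f hef)), hlength⟩

theorem theorem1 (t : ℕ) (ht : 2 ≤ t) :
    ∃ c : ℝ, 0 < c ∧
      ∀ (n : ℕ), t ≤ n →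
        ∀ (V : Type u) [Fintype V] (C : Type v) (G : SimpleGraph V) (χ : G.EdgeLabeling C),
          Fintype.card V = n →
          RainbowSubdivision.IsProper χ →
          (n : ℝ) * Real.exp (c * Real.sqrt (Real.log n)) ≤ (G.edgeSet.ncard : ℝ) →
          ∃ D : RainbowSubdivision.CliqueSubdivision G t,
            RainbowSubdivision.IsRainbow χ D.toSubgraph ∧
            ∀ (i j : Fin t) (h : i < j),
              ((D.path i j h : G.Walk (D.branch i) (D.branch j)).length : ℝ)
                ≤ 1300 * Real.log n ^ 2 := by
  obtain ⟨c, hc, hexp⟩ :=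
    exists_mul_log_pow_mul_le_mul_exp (10 ^ 12 * (t : ℝ) ^ 2) (by norm_num : 9 ≠ 0)
  refine ⟨c, hc, ?_⟩
  rintro n hn V _ C G χ rfl hχ hG
  have : Nontrivial V := Fintype.one_lt_card_iff_nontrivial.1 (ht.trans hn)
  obtain ⟨D, hD, hlength⟩ := theorem1_general (two_pos.trans_le ht) hχ ((hexp _).trans hG)
  exact ⟨D, hD, fun i j h => (hlength i j h).trans (by gcongr; norm_num)⟩
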